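/- A \emph{staircase tableau} of size $n\ge 1$ is a filling of the Young diagram of shape $(n,n-1,\dots,2,1)$ (in English notation; row $i$ from the top has $n+1-i$ left-justified boxes, and the last box of each row is a diagonal box) such that: each box is empty or contains one of the letters $\alpha,\beta,\gamma,\delta$; no diagonal box is empty; all boxes in the same row and to the left of a $\beta$ or a $\delta$ are empty; all boxes in the same column and above an $\alpha$ or a $\gamma$ are empty. Let $\mathcal S_n$ be the finite set of staircase tableaux of size $n$, equipped with the uniform probability measure, and for $S\in\mathcal S_n$ let $\Delta_n(S)$ be the total number of boxes containing $\beta$ or $\delta$ and $\Gamma_n(S)$ the total number of boxes containing $\alpha$ or $\gamma$. Write $H_n=\sum_{k=1}^n \frac1k$ and $H_n^{(2)}=\sum_{k=1}^n\frac1{k^2}$. (i) For every $n\ge1$, $$\Delta_n\stackrel{d}{=}\sum_{k=1}^n I_k,$$ where $I_1,\dots,I_n$ are independent random variables with $P(I_k=1)=1-\frac1{2k}$ and $P(I_k=0)=\frac1{2k}$. In particular, $$\mathbb E\,\Delta_n=n-\frac{H_n}2,\qquad \operatorname{var}(\Delta_n)=\frac{H_n}2-\frac{H_n^{(2)}}4,$$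 and, as $n\to\infty$, $$\frac{\Delta_n-n+\frac12\ln n}{\sqrt{\frac12\ln n}}\stackrel{d}{\longrightarrow}N(0,1).$$ (ii) For every $n\ge1$, $\Gamma_n\stackrel{d}{=}\Delta_n$. In particular, the three statements of (i) (the representation as a sum of independent Bernoulli variables, the formulas for the mean and the variance, and the convergence to $N(0,1)$) hold with $\Delta_n$ replaced by $\Gamma_n$. -/

import Mathlib

open MeasureTheory ProbabilityTheory Filter

/-- The four letters that may fill the boxes of a staircase tableau. -/
inductive Letter : Type where
  | alpha
  | beta
  | gamma
  | delta
  deriving DecidableEq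

instance : Fintype Letter where
  elems := {Letter.alpha, Letter.beta, Letter.gamma, Letter.delta}
  complete := fun x => by cases x <;> simp

/-- The box contains `α` or `γ` (`none` stands for an empty box). -/
def IsAlphaGamma (x : Option Letter) : Prop :=
  x = some Letter.alpha ∨ x = some Letter.gamma

/-- The box contains `β` or `δ` (`none` stands for an empty box). -/
def IsBetaDelta (x : Option Letter) : Prop :=
  x = some Letter.beta ∨ x = some Letter.delta

instance : DecidablePred IsAlphaGamma := fun x => by
  unfold IsAlphaGamma
  infer_instance

instance : DecidablePred IsBetaDelta := fun x => by
  unfold IsBetaDelta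
  infer_instance

/-- The filling rules of staircase tableaux of size `n`. Rows are numbered `0, …, n - 1` from top to
bottom and columns `0, …, n - 1` from left to right. The Young diagram of shape
`(n, n - 1, …, 1)` has a box at `(i, j)` exactly when `i + j < n`; its diagonal consists of the boxes
with `i + j + 1 = n`. Positions outside of the diagram carry the value `none`. -/
structure IsStaircaseTableau (n : ℕ) (T : Fin n → Fin n → Option Letter) : Prop where
  outside : ∀ i j : Fin n, n ≤ (i : ℕ) + (j : ℕ) → T i j = none
  diagonal : ∀ i j : Fin n, (i : ℕ) + (j : ℕ) + 1 = n → T i j ≠ none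
  left_empty : ∀ i j : Fin n, IsBetaDelta (T i j) → ∀ j' : Fin n, j' < j → T i j' = none
  above_empty : ∀ i j : Fin n, IsAlphaGamma (T i j) → ∀ i' : Fin n, i' < i → T i' j = none

/-- The set `𝒮ₙ` of staircase tableaux of size `n`. -/
def StaircaseTableau (n : ℕ) : Type :=
  {T : Fin n → Fin n → Option Letter // IsStaircaseTableau n T}

namespace StaircaseTableau

instance (n : ℕ) : Finite (StaircaseTableau n) :=
  inferInstanceAs (Finite {T : Fin n → Fin n → Option Letter // IsStaircaseTableau n T})

/-- The tableau with `α` in all diagonal boxes and no other letters. -/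
instance (n : ℕ) : Nonempty (StaircaseTableau n) := by
  refine ⟨⟨fun i j => if (i : ℕ) + (j : ℕ) + 1 = n then some Letter.alpha else none, ?_⟩⟩
  refine ⟨fun i j h => if_neg (by omega), fun i j h => by simp [h], fun i j h => ?_,
    fun i j h i' hi => ?_⟩
  · exfalso
    by_cases hij : (i : ℕ) + (j : ℕ) + 1 = n <;> simp [IsBetaDelta, hij] at h
  · by_cases hij : (i : ℕ) + (j : ℕ) + 1 = n
    · have : (i' : ℕ) < i := hi
      exact if_neg (by omega)
    · simp [IsAlphaGamma, hij] at h

/-- All subsets of the finite set `𝒮ₙ` are events. -/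
instance (n : ℕ) : MeasurableSpace (StaircaseTableau n) := ⊤

instance (n : ℕ) : DiscreteMeasurableSpace (StaircaseTableau n) := ⟨fun _ => trivial⟩

/-- The total number `Δₙ` of entries `β` or `δ`. -/
def Delta {n : ℕ} (S : StaircaseTableau n) : ℕ :=
  (Finset.univ.filter fun p : Fin n × Fin n => IsBetaDelta (S.1 p.1 p.2)).card

/-- The total number `Γₙ` of entries `α` or `γ`. -/
def Gamma {n : ℕ} (S : StaircaseTableau n) : ℕ :=
  (Finset.univ.filter fun p : Fin n × Fin n => IsAlphaGamma (S.1 p.1 p.2)).card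

/-- The uniform probability measure `Pₙ` on `𝒮ₙ`. -/
noncomputable def unif (n : ℕ) : Measure (StaircaseTableau n) := uniformOn Set.univ

instance (n : ℕ) : IsProbabilityMeasure (unif n) :=
  inferInstanceAs (IsProbabilityMeasure (uniformOn (Set.univ : Set (StaircaseTableau n))))

end StaircaseTableau

/-- `I₁, …, Iₙ` are independent real random variables on `(Ω, P)` with
`P(I_k = 1) = 1 - 1/(2k)` and `P(I_k = 0) = 1/(2k)`; the variable `I_k` is `I i` where `i : Fin n`
has the value `k - 1`. -/
structure IsIndepBernoulli {Ω : Type*} [MeasurableSpace Ω] (P : Measure Ω) (n : ℕ)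
    (I : Fin n → Ω → ℝ) : Prop where
  measurable : ∀ i, Measurable (I i)
  indep : iIndepFun I P
  prob_one : ∀ i : Fin n, P.real {ω | I i ω = 1} = 1 - 1 / (2 * ((i : ℝ) + 1))
  prob_zero : ∀ i : Fin n, P.real {ω | I i ω = 0} = 1 / (2 * ((i : ℝ) + 1))

/-!
Weight a tableau `T` by `x ^ Δ(T) * y ^ Γ(T) * z ^ r(T)`, where `r(T)` is the number of rows without
`β` and `δ`, and let `Rₙ(z)` be the sum of the weights over all tableaux of size `n`. A tableau of
size `n + 1` is a tableau `T` of size `n` with a new leftmost column of height `n + 1`, and the rules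
restrict that column only through the set of rows of `T` without `β` and `δ`: the other rows
have to stay empty in it. Reading the column from top to bottom, the sum over all admissible columns
is `(2x + 2yz) (z + 2x) ^ r(T)` (`sum_column`), whence `Rₙ₊₁(z) = (2x + 2yz) Rₙ(z + 2x)` and
`Rₙ(z) = ∏_{k < n} (2x + 2y (z + 2kx))` (`sum_prod_boxWeight`). At `z = 1` this is the joint
generating function `∏_{k < n} (2x + 2y + 4kxy)` of `Δ` and `Γ`, which is symmetric in `x` and `y`.

Setting `y = 1` and dividing by the value at `x = 1`, both `Δ` and `Γ` have the probability generating
function `∏_{k=1}^n (1/(2k) + (1 - 1/(2k)) x)` of the sum of the independent Bernoulli variables.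
At `x = exp (i t)` these are characteristic functions, so the laws agree, and the mean and the
variance follow by additivity.

For the limit theorem, put `L = ½ log n`, `s = t / √L` and `u = exp (-i s) - 1`. The characteristic
function of the normalized variable at `t` is `exp (i s L) ∏_{k=1}^n (1 + u / (2k))`. The
product is within `O(|u|²)` of `exp (u Hₙ / 2)` (`norm_prod_sub_exp_le`), and
`i s L + u Hₙ / 2 → -t² / 2` by the Taylor expansion of `u` and `Hₙ = 2 L + O(1)`. The theorem follows
by Lévy's continuity theorem.
-/

/-! ### Columns -/

/-- The weight of a box: `x` for `β` and `δ`, `y` for `α` and `γ`, and `1` for an empty box. -/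
noncomputable def boxWeight (x y : ℂ) (o : Option Letter) : ℂ :=
  (if IsBetaDelta o then x else 1) * (if IsAlphaGamma o then y else 1)

/-- `c` is admissible as the new leftmost column (of height `n + 1`, listed from top to bottom) of a
tableau, where `F i` says that row `i` may still be extended to the left. The last box is the new
diagonal box. -/
structure IsColumn {n : ℕ} (F : Fin (n + 1) → Prop) (c : Fin (n + 1) → Option Letter) : Prop where
  last : c (Fin.last n) ≠ none
  free : ∀ i, ¬ F i → c i = none
  above_empty : ∀ i, IsAlphaGamma (c i) → ∀ i' < i, c i' = none

open scoped Classical in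
/-- The weight that a box `o` of the new column contributes in a row, `f` telling whether this row may
be extended: its own weight, and a factor `z` if the row can still be extended afterwards. -/
noncomputable def rowWeight (x y z : ℂ) (f : Prop) (o : Option Letter) : ℂ :=
  boxWeight x y o * (if f ∧ ¬ IsBetaDelta o then z else 1)

theorem sum_option_letter (f : Option Letter → ℂ) :
    ∑ o, f o = f none + (f (some .alpha) + f (some .beta) + f (some .gamma) + f (some .delta)) := by
  rw [Fintype.sum_option]
  congr 1
  have : (Finset.univ : Finset Letter) = {Letter.alpha, Letter.beta, Letter.gamma, Letter.delta} := rfl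
  rw [this]
  simp
  ring

/-- A nonempty top box of a column needs an extensible row and no `α` or `γ` below it. -/
theorem isColumn_cons {n : ℕ} (F : Fin (n + 2) → Prop) (o : Option Letter)
    (c : Fin (n + 1) → Option Letter) :
    IsColumn F (Fin.cons o c : Fin (n + 2) → Option Letter) ↔
      IsColumn (fun i => F i.succ) c ∧ (o = none ∨ F 0 ∧ ∀ i, ¬ IsAlphaGamma (c i)) := by
  constructor
  · rintro ⟨h1, h2, h3⟩
    refine ⟨⟨?_, fun i hi => by simpa using h2 i.succ hi, fun i hi i' hi' => ?_⟩, ?_⟩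
    · simpa [← Fin.succ_last] using h1
    · simpa using h3 i.succ (by simpa using hi) i'.succ (by simpa using hi')
    · by_cases ho : o = none
      · exact Or.inl ho
      · refine Or.inr ⟨?_, fun i hi => ho ?_⟩
        · by_contra hF
          exact ho (by simpa using h2 0 hF)
        · simpa using h3 i.succ (by simpa using hi) 0 (Fin.succ_pos i)
  · rintro ⟨⟨h1, h2, h3⟩, h⟩
    refine ⟨?_, fun i hi => ?_, fun i hi i' hi' => ?_⟩
    · simpa [← Fin.succ_last] using h1
    · induction i using Fin.cases with
      | zero => exact h.resolve_right fun h => hi h.1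
      | succ i => simpa using h2 i hi
    · induction i using Fin.cases with
      | zero => exact absurd hi' (Fin.not_lt_zero _)
      | succ i =>
        simp only [Fin.cons_succ] at hi
        induction i' using Fin.cases with
        | zero => exact h.resolve_right fun h => h.2 i hi
        | succ i' => simpa using h3 i hi i' (by simpa using hi')

theorem sum_fin_cons {n : ℕ} (f : (Fin (n + 1) → Option Letter) → ℂ) :
    ∑ c, f c = ∑ o : Option Letter, ∑ c : Fin n → Option Letter, f (Fin.cons o c) := by
  rw [← Fintype.sum_prod_type' (f := fun o c => f (Fin.cons o c))]
  exact (Fintype.sum_equiv (Fin.consEquiv fun _ : Fin (n + 1) => Option Letter) _ _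
    fun p => rfl).symm

open scoped Classical in
/-- At `y = 0` the weight is supported on the columns without `α` and `γ`, and on these it does not
depend on `y`. -/
theorem prod_rowWeight_zero {ι : Type*} [Fintype ι] (x y z : ℂ) (F : ι → Prop)
    (c : ι → Option Letter) :
    ∏ i, rowWeight x 0 z (F i) (c i) =
      if ∀ i, ¬ IsAlphaGamma (c i) then ∏ i, rowWeight x y z (F i) (c i) else 0 := by
  split_ifs with h
  · exact Finset.prod_congr rfl fun i _ => by simp [rowWeight, boxWeight, h i]
  · push Not at h
    obtain ⟨i, hi⟩ := h
    exact Finset.prod_eq_zero (Finset.mem_univ i) (by simp [rowWeight, boxWeight, hi])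

open scoped Classical in
/-- The generating function of the admissible columns. The product runs over the rows
other than the last one, which holds the new diagonal box. -/
theorem sum_column (x y z : ℂ) : ∀ {n : ℕ} (F : Fin (n + 1) → Prop), F (Fin.last n) →
    ∑ c : Fin (n + 1) → Option Letter, (if IsColumn F c then
      ∏ i, rowWeight x y z (F i) (c i) else 0) =
    (2 * x + 2 * y * z) * ∏ i : Fin n, (if F i.castSucc then z + 2 * x else 1) := by
  intro n
  induction n generalizing y with
  | zero =>
    intro F hF
    rw [sum_fin_cons]
    have h0 : F 0 := hF
    have hs : ∀ i : Fin (0 + 1), i = 0 := fun i => Subsingleton.elim (α := Fin 1) i 0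
    have key (o : Option Letter) (c : Fin 0 → Option Letter) :
        IsColumn F (Fin.cons o c : Fin 1 → Option Letter) ↔ o ≠ none := by
      refine ⟨fun h => h.last, fun h => ⟨h, fun i hi => absurd h0 (by rwa [hs i] at hi),
        fun i _ i' hi' => absurd hi' (by simp [hs i])⟩⟩
    simp only [key]
    rw [sum_option_letter]
    simp [IsBetaDelta, IsAlphaGamma, rowWeight, boxWeight, h0]
    ring
  | succ n ih =>
    intro F hF
    have hF' : F (Fin.last n).succ := by simpa [← Fin.succ_last] using hF
    have ih₁ := ih y (fun i => F i.succ) hF'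
    -- Below a nonempty top box the rest of the column must avoid `α` and `γ`:
    -- the corresponding sum is the induction hypothesis at `y = 0`.
    have ih₀ := ih 0 (fun i => F i.succ) hF'
    simp only [prod_rowWeight_zero x y] at ih₀
    rw [sum_fin_cons, Fin.prod_univ_succ]
    simp only [isColumn_cons, Fin.prod_univ_succ (n := n + 1), Fin.cons_zero, Fin.cons_succ]
    have key (o : Option Letter) : ∑ c : Fin (n + 1) → Option Letter,
        (if IsColumn (fun i => F i.succ) c ∧ (o = none ∨ F 0 ∧ ∀ i, ¬ IsAlphaGamma (c i)) then
          rowWeight x y z (F 0) o * ∏ i, rowWeight x y z (F i.succ) (c i) else 0) =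
        if o = none then rowWeight x y z (F 0) none *
          ((2 * x + 2 * y * z) * ∏ i : Fin n, (if F i.castSucc.succ then z + 2 * x else 1))
        else (if F 0 then rowWeight x y z (F 0) o else 0) *
          ((2 * x + 2 * 0 * z) *
            ∏ i : Fin n, (if F i.castSucc.succ then z + 2 * x else 1)) := by
      rw [← ih₁, ← ih₀]
      split_ifs with h h' <;> rw [Finset.mul_sum] <;> refine Finset.sum_congr rfl fun c _ => ?_
      · subst h
        simp
      · simp only [h, h', false_or, true_and]
        split_ifs <;> first | rfl | simp_all
      · simp [h, h']
    refine (Finset.sum_congr rfl fun o _ => key o).trans ?_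
    rw [sum_option_letter]
    simp only [Fin.castSucc_zero, ← Fin.castSucc_succ]
    by_cases h : F 0 <;>
      simp [IsBetaDelta, IsAlphaGamma, rowWeight, boxWeight, h]
    ring

/-! ### Tableaux and their generating function -/

/-- Row `i` contains neither `β` nor `δ`, so that letters may be added on its left. -/
def FreeRow {n m : ℕ} (T : Fin n → Fin m → Option Letter) (i : Fin n) : Prop :=
  ∀ j, ¬ IsBetaDelta (T i j)

/-- The rows of the new column that may be filled: the free rows of `T`, and the new last row. -/
def ExtensibleRow {n m : ℕ} (T : Fin n → Fin m → Option Letter) (i : Fin (n + 1)) : Prop :=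
  ∀ i' : Fin n, i'.castSucc = i → FreeRow T i'

theorem extensibleRow_last {n m : ℕ} (T : Fin n → Fin m → Option Letter) :
    ExtensibleRow T (Fin.last n) :=
  fun i' h => absurd h (Fin.castSucc_ne_last i')

theorem extensibleRow_castSucc {n m : ℕ} (T : Fin n → Fin m → Option Letter) (i : Fin n) :
    ExtensibleRow T i.castSucc ↔ FreeRow T i := by
  simp [ExtensibleRow]

/-- Add the column `c` on the left of `T` and a row below, which has no box outside of `c`. -/
def addColumn {n : ℕ} (T : Fin n → Fin n → Option Letter) (c : Fin (n + 1) → Option Letter) :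
    Fin (n + 1) → Fin (n + 1) → Option Letter :=
  fun i => Fin.cons (c i) (Fin.snoc (α := fun _ => Fin n → Option Letter) T (fun _ => none) i)

section addColumn

variable {n : ℕ} (T : Fin n → Fin n → Option Letter) (c : Fin (n + 1) → Option Letter)

@[simp]
theorem addColumn_zero (i : Fin (n + 1)) : addColumn T c i 0 = c i := rfl

@[simp]
theorem addColumn_last_succ (j : Fin n) : addColumn T c (Fin.last n) j.succ = none := by
  simp [addColumn]

@[simp]
theorem addColumn_castSucc_succ (i j : Fin n) : addColumn T c i.castSucc j.succ = T i j := by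
  simp [addColumn]

theorem isStaircaseTableau_addColumn :
    IsStaircaseTableau (n + 1) (addColumn T c) ↔
      IsStaircaseTableau n T ∧ IsColumn (ExtensibleRow T) c := by
  constructor
  · rintro ⟨h1, h2, h3, h4⟩
    refine ⟨⟨fun i j h => ?_, fun i j h => ?_, fun i j h j' hj => ?_, fun i j h i' hi => ?_⟩,
      ⟨?_, fun i hi => ?_, fun i hi i' hi' => ?_⟩⟩
    · simpa using h1 i.castSucc j.succ (by simp; omega)
    · simpa using h2 i.castSucc j.succ (by simp; omega)
    · simpa using h3 i.castSucc j.succ (by simpa using h) j'.succ (by simpa using hj)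
    · simpa using h4 i.castSucc j.succ (by simpa using h) i'.castSucc (by simpa using hi)
    · simpa using h2 (Fin.last n) 0 (by simp)
    · simp only [ExtensibleRow, FreeRow, not_forall, not_not] at hi
      obtain ⟨i', rfl, j, hj⟩ := hi
      simpa using h3 i'.castSucc j.succ (by simpa using hj) 0 (Fin.succ_pos j)
    · simpa using h4 i 0 (by simpa using hi) i' hi'
  · rintro ⟨⟨h1, h2, h3, h4⟩, ⟨c1, c2, c3⟩⟩
    refine ⟨fun i j h => ?_, fun i j h => ?_, fun i j h j' hj => ?_, fun i j h i' hi => ?_⟩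
    · induction j using Fin.cases with
      | zero => exact absurd h (by simp; omega)
      | succ j =>
        induction i using Fin.lastCases with
        | last => simp
        | cast i => simpa using h1 i j (by simp at h; omega)
    · induction j using Fin.cases with
      | zero =>
        obtain rfl : i = Fin.last n := Fin.ext (by simpa using h)
        simpa using c1
      | succ j =>
        induction i using Fin.lastCases with
        | last => simp at h
        | cast i => simpa using h2 i j (by simp at h; omega)
    · induction j using Fin.cases with
      | zero => exact absurd hj (Fin.not_lt_zero _)
      | succ j =>
        induction i using Fin.lastCases with
        | last => simp [IsBetaDelta] at h
        | cast i =>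
          rw [addColumn_castSucc_succ] at h
          induction j' using Fin.cases with
          | zero => exact c2 _ fun hF => (extensibleRow_castSucc T i).1 hF j h
          | succ j' => simpa using h3 i j h j' (by simpa using hj)
    · induction j using Fin.cases with
      | zero => exact c3 i h i' hi
      | succ j =>
        induction i using Fin.lastCases with
        | last => simp [IsAlphaGamma] at h
        | cast i =>
          rw [addColumn_castSucc_succ] at h
          induction i' using Fin.lastCases with
          | last => exact absurd hi (by simpa using (Fin.le_last _))
          | cast i' => simpa using h4 i j h i' (by simpa using hi)

theorem freeRow_addColumn (i : Fin (n + 1)) :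
    FreeRow (addColumn T c) i ↔ ExtensibleRow T i ∧ ¬ IsBetaDelta (c i) := by
  induction i using Fin.lastCases with
  | last => simp [FreeRow, Fin.forall_fin_succ, extensibleRow_last, IsBetaDelta]
  | cast i => simp [FreeRow, Fin.forall_fin_succ, extensibleRow_castSucc, and_comm]

end addColumn

/-- A tableau of size `n + 1` is a tableau of size `n` together with an admissible column. -/
noncomputable def addColumnEquiv (n : ℕ) :
    (Σ T : StaircaseTableau n, {c // IsColumn (ExtensibleRow T.1) c}) ≃ StaircaseTableau (n + 1) :=
  Equiv.ofBijective
    (fun p => ⟨addColumn p.1.1 p.2.1, (isStaircaseTableau_addColumn _ _).2 ⟨p.1.2, p.2.2⟩⟩) <| by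
    constructor
    · rintro ⟨⟨T, hT⟩, c, hc⟩ ⟨⟨T', hT'⟩, c', hc'⟩ h
      have h := congrArg Subtype.val h
      obtain rfl : T = T' := by
        funext i j
        simpa using congrFun (congrFun h i.castSucc) j.succ
      obtain rfl : c = c' := by
        funext i
        simpa using congrFun (congrFun h i) 0
      rfl
    · rintro ⟨S, hS⟩
      have e : addColumn (fun i j => S i.castSucc j.succ) (fun i => S i 0) = S := by
        funext i j
        induction j using Fin.cases with
        | zero => rfl
        | succ j =>
          induction i using Fin.lastCases with
          | last => simpa using (hS.outside (Fin.last n) j.succ (by simp)).symm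
          | cast i => simp
      have h := hS
      rw [← e, isStaircaseTableau_addColumn] at h
      exact ⟨⟨⟨_, h.1⟩, ⟨_, h.2⟩⟩, Subtype.ext e⟩

noncomputable instance (n : ℕ) : Fintype (StaircaseTableau n) := Fintype.ofFinite _

open scoped Classical in
theorem prod_addColumn (x y z : ℂ) {n : ℕ} (T : Fin n → Fin n → Option Letter)
    (c : Fin (n + 1) → Option Letter) :
    (∏ i, ∏ j, boxWeight x y (addColumn T c i j)) *
        ∏ i, (if FreeRow (addColumn T c) i then z else 1) =
      (∏ i, ∏ j, boxWeight x y (T i j)) * ∏ i, rowWeight x y z (ExtensibleRow T i) (c i) := by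
  have e : ∏ i, ∏ j, boxWeight x y (addColumn T c i j) =
      (∏ i, ∏ j, boxWeight x y (T i j)) * ∏ i, boxWeight x y (c i) := by
    simp only [Fin.prod_univ_succ (n := n) (f := fun j => boxWeight x y (addColumn T c _ j)),
      addColumn_zero, Finset.prod_mul_distrib]
    rw [Fin.prod_univ_castSucc (f := fun i => ∏ j : Fin n, _)]
    rw [mul_comm]
    congr 1
    simp [boxWeight, IsBetaDelta, IsAlphaGamma, -mul_ite, -ite_mul]
  rw [e, mul_assoc, ← Finset.prod_mul_distrib]
  simp only [freeRow_addColumn, rowWeight]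

open scoped Classical in
/-- The generating function refined by the number of free rows, `∏_{k < n} (2x + 2y (z + 2kx))`. The
variable `z` is needed for the induction, where adding a column replaces it by `z + 2x`. -/
theorem sum_prod_boxWeight (x y : ℂ) (n : ℕ) (z : ℂ) :
    ∑ S : StaircaseTableau n,
      (∏ i, ∏ j, boxWeight x y (S.1 i j)) * ∏ i, (if FreeRow S.1 i then z else 1) =
    ∏ k ∈ Finset.range n, (2 * x + 2 * y * (z + k * (2 * x))) := by
  induction n generalizing z with
  | zero =>
    have : Subsingleton (StaircaseTableau 0) :=
      inferInstanceAs (Subsingleton {T // IsStaircaseTableau 0 T})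
    rw [Fintype.sum_subsingleton _ (Classical.arbitrary _)]
    simp
  | succ n ih =>
    rw [← (addColumnEquiv n).sum_comp, Fintype.sum_sigma, Finset.prod_range_succ']
    have key (T : StaircaseTableau n) :
        ∑ c : {c // IsColumn (ExtensibleRow T.1) c},
          (∏ i, ∏ j, boxWeight x y ((addColumnEquiv n ⟨T, c⟩).1 i j)) *
            ∏ i, (if FreeRow (addColumnEquiv n ⟨T, c⟩).1 i then z else 1) =
        ((∏ i, ∏ j, boxWeight x y (T.1 i j)) * ∏ i, (if FreeRow T.1 i then z + 2 * x else 1)) *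
          (2 * x + 2 * y * z) := by
      have h := sum_column x y z (ExtensibleRow T.1) (extensibleRow_last T.1)
      simp only [extensibleRow_castSucc] at h
      rw [mul_assoc, mul_comm _ (2 * x + 2 * y * z), ← h, Finset.mul_sum]
      simp only [mul_ite, mul_zero]
      rw [← Finset.sum_filter, Finset.sum_subtype (p := IsColumn (ExtensibleRow T.1)) _ (by simp)]
      exact Finset.sum_congr rfl fun c _ => prod_addColumn x y z T.1 c.1
    rw [Finset.sum_congr rfl fun T _ => key T, ← Finset.sum_mul, ih]
    congr 1
    · refine Finset.prod_congr rfl fun k _ => ?_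
      push_cast
      ring
    · simp

theorem prod_boxWeight (x y : ℂ) {n : ℕ} (S : StaircaseTableau n) :
    ∏ i, ∏ j, boxWeight x y (S.1 i j) = x ^ S.Delta * y ^ S.Gamma := by
  rw [← Fintype.prod_prod_type']
  simp [boxWeight, -mul_ite, -ite_mul, Finset.prod_mul_distrib, Finset.prod_ite, StaircaseTableau.Delta,
    StaircaseTableau.Gamma]

/-- The joint generating function of `Δ` and `Γ`. It is symmetric in `x` and `y`. -/
theorem sum_pow_Delta_mul_pow_Gamma (x y : ℂ) (n : ℕ) :
    ∑ S : StaircaseTableau n, x ^ S.Delta * y ^ S.Gamma =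
      ∏ k ∈ Finset.range n, (2 * x + 2 * y + 4 * k * x * y) := by
  have h := sum_prod_boxWeight x y n 1
  simp only [prod_boxWeight, ite_self, Finset.prod_const_one, mul_one] at h
  rw [h]
  exact Finset.prod_congr rfl fun k _ => by ring

/-! ### The law of the number of letters -/

theorem integral_unif {n : ℕ} (f : StaircaseTableau n → ℂ) :
    ∫ S, f S ∂StaircaseTableau.unif n = (∑ S, f S) / Fintype.card (StaircaseTableau n) := by
  rw [StaircaseTableau.unif, uniformOn, ProbabilityTheory.cond]
  simp [integral_smul_measure, integral_count, div_eq_inv_mul]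

/-- The probability generating function `∏_{k=1}^n (1/(2k) + (1 - 1/(2k)) x)` of the sum of
independent Bernoulli variables with parameters `1 - 1/(2k)`; the factors are indexed by `k - 1`. -/
noncomputable def bernoulliSumPGF (n : ℕ) (x : ℂ) : ℂ :=
  ∏ k ∈ Finset.range n, (1 / (2 * ((k : ℂ) + 1)) + (1 - 1 / (2 * ((k : ℂ) + 1))) * x)

theorem card_staircaseTableau (n : ℕ) :
    (Fintype.card (StaircaseTableau n) : ℂ) = ∏ k ∈ Finset.range n, (4 * ((k : ℂ) + 1)) := by
  have h := sum_pow_Delta_mul_pow_Gamma 1 1 n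
  simp only [one_pow, mul_one, Finset.sum_const, Finset.card_univ, nsmul_eq_mul] at h
  rw [h]
  exact Finset.prod_congr rfl fun k _ => by ring

theorem prod_div_card_staircaseTableau (x : ℂ) (n : ℕ) :
    (∏ k ∈ Finset.range n, (2 * x + 2 + 4 * k * x)) / Fintype.card (StaircaseTableau n) =
      bernoulliSumPGF n x := by
  rw [card_staircaseTableau, bernoulliSumPGF, ← Finset.prod_div_distrib]
  refine Finset.prod_congr rfl fun k _ => ?_
  have : (k : ℂ) + 1 ≠ 0 := Nat.cast_add_one_ne_zero k
  field_simp
  ring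

theorem integral_pow_Delta (n : ℕ) (x : ℂ) :
    ∫ S : StaircaseTableau n, x ^ S.Delta ∂StaircaseTableau.unif n = bernoulliSumPGF n x := by
  rw [integral_unif, ← prod_div_card_staircaseTableau]
  congr 1
  simpa using sum_pow_Delta_mul_pow_Gamma x 1 n

theorem integral_pow_Gamma (n : ℕ) (x : ℂ) :
    ∫ S : StaircaseTableau n, x ^ S.Gamma ∂StaircaseTableau.unif n = bernoulliSumPGF n x := by
  rw [integral_unif, ← prod_div_card_staircaseTableau]
  congr 1
  have h := sum_pow_Delta_mul_pow_Gamma 1 x n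
  simp only [one_pow, one_mul, mul_one] at h
  rw [h]
  exact Finset.prod_congr rfl fun k _ => by ring

theorem exists_isIndepBernoulli (n : ℕ) :
    ∃ (Ω : Type) (_ : MeasurableSpace Ω) (P : Measure Ω) (I : Fin n → Ω → ℝ),
      IsProbabilityMeasure P ∧ IsIndepBernoulli P n I := by
  have hp (i : Fin n) : 1 - 1 / (2 * ((i : ℝ) + 1)) ∈ unitInterval := by
    have h : (0 : ℝ) ≤ i := Nat.cast_nonneg _
    refine ⟨sub_nonneg.2 ?_, sub_le_self _ (by positivity)⟩
    rw [div_le_one (by positivity)]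
    linarith
  obtain ⟨Ω, _, P, I, hI, hlaw, hind, hP⟩ := exists_hasLaw_indepFun (fun _ : Fin n => ℝ)
    (fun i => bernoulliMeasure (1 : ℝ) 0 ⟨_, hp i⟩)
  have h (i : Fin n) (a : ℝ) : P.real {ω | I i ω = a} =
      (bernoulliMeasure (1 : ℝ) 0 ⟨_, hp i⟩).real {a} := by
    rw [← (hlaw i).map_eq, map_measureReal_apply (hI i) (measurableSet_singleton a)]
    rfl
  refine ⟨Ω, _, P, I, hP, hI, hind, fun i => ?_, fun i => ?_⟩
  · rw [h, bernoulliMeasure_real_apply_of_mem_of_notMem _ (measurableSet_singleton _) rfl (by simp)]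
  · rw [h, bernoulliMeasure_real_apply_of_notMem_of_mem _ (measurableSet_singleton _) (by simp) rfl]
    simp

namespace IsIndepBernoulli

variable {Ω : Type*} [MeasurableSpace Ω] {P : Measure Ω} [IsProbabilityMeasure P] {n : ℕ}
  {I : Fin n → Ω → ℝ}

theorem ae_eq_zero_or_one (h : IsIndepBernoulli P n I) (i : Fin n) :
    ∀ᵐ ω ∂P, I i ω = 0 ∨ I i ω = 1 := by
  have h0 : MeasurableSet {ω | I i ω = 0} := h.measurable i (measurableSet_singleton 0)
  have h1 : MeasurableSet {ω | I i ω = 1} := h.measurable i (measurableSet_singleton 1)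
  have hd : Disjoint {ω | I i ω = 0} {ω | I i ω = 1} := by
    rw [Set.disjoint_left]
    intro ω (hω : I i ω = 0) (hω' : I i ω = 1)
    norm_num [hω] at hω'
  have hr : P.real ({ω | I i ω = 0} ∪ {ω | I i ω = 1}) = 1 := by
    rw [measureReal_union hd h1, h.prob_zero, h.prob_one]
    ring
  refine (mem_ae_iff_prob_eq_one (h0.union h1)).2 ?_
  rwa [measureReal_def, ENNReal.toReal_eq_one_iff] at hr

theorem memLp (h : IsIndepBernoulli P n I) (i : Fin n) (p : ENNReal) : MemLp (I i) p P := by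
  refine MemLp.of_bound (h.measurable i).aestronglyMeasurable 1 ?_
  filter_upwards [h.ae_eq_zero_or_one i] with ω hω
  rcases hω with hω | hω <;> simp [hω]

theorem integral_eq (h : IsIndepBernoulli P n I) (i : Fin n) :
    ∫ ω, I i ω ∂P = 1 - 1 / (2 * ((i : ℝ) + 1)) := by
  rw [integral_of_ae_eq_zero_or_one (h.measurable i).aemeasurable (h.ae_eq_zero_or_one i),
    h.prob_one]

theorem charFun_map_sum (h : IsIndepBernoulli P n I) (t : ℝ) :
    charFun (P.map fun ω => ∑ i, I i ω) t = bernoulliSumPGF n (Complex.exp (t * Complex.I)) := by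
  rw [h.indep.charFun_map_fun_sum_eq_prod (fun i => (h.measurable i).aemeasurable),
    Finset.prod_apply, bernoulliSumPGF, Finset.prod_range]
  refine Finset.prod_congr rfl fun i _ => ?_
  rw [charFun_apply_real, integral_map (h.measurable i).aemeasurable (by fun_prop)]
  have e : ∀ᵐ ω ∂P, Complex.exp (t * I i ω * Complex.I) =
      1 + (Complex.exp (t * Complex.I) - 1) * (I i ω : ℂ) := by
    filter_upwards [h.ae_eq_zero_or_one i] with ω hω
    rcases hω with hω | hω <;> simp [hω]
  have hint : Integrable (fun ω => (I i ω : ℂ)) P :=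
    (memLp_one_iff_integrable.1 (h.memLp i 1)).ofReal
  rw [integral_congr_ae e, integral_add (integrable_const _) (hint.const_mul _),
    integral_const_mul, integral_complex_ofReal, h.integral_eq]
  simp
  ring

theorem integral_sum (h : IsIndepBernoulli P n I) :
    ∫ ω, ∑ i, I i ω ∂P = n - (harmonic n : ℝ) / 2 := by
  rw [integral_finsetSum _ fun i _ => memLp_one_iff_integrable.1 (h.memLp i 1)]
  simp only [h.integral_eq]
  rw [← Finset.sum_range fun k => 1 - 1 / (2 * ((k : ℝ) + 1)), Finset.sum_sub_distrib, harmonic]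
  push_cast
  rw [Finset.sum_div]
  simp
  exact Finset.sum_congr rfl fun k _ => by field_simp

theorem variance_sum (h : IsIndepBernoulli P n I) :
    Var[fun ω => ∑ i, I i ω; P] =
      (harmonic n : ℝ) / 2 - (∑ k ∈ Finset.Icc 1 n, 1 / (k : ℝ) ^ 2) / 4 := by
  have hv := IndepFun.variance_sum (s := Finset.univ) (fun i _ => h.memLp i 2)
    (fun i _ j _ hij => h.indep.indepFun hij)
  have e : (∑ i, I i) = fun ω => ∑ i, I i ω := by
    ext ω
    simp
  rw [e] at hv
  rw [hv]
  simp only [variance_of_ae_eq_zero_or_one (h.measurable _).aemeasurable (h.ae_eq_zero_or_one _),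
    h.prob_zero, h.prob_one]
  rw [← Finset.sum_range fun k => 1 / (2 * ((k : ℝ) + 1)) * (1 - 1 / (2 * ((k : ℝ) + 1))),
    Finset.range_eq_Ico, ← Finset.Ico_succ_right_eq_Icc, Nat.succ_eq_succ,
    Finset.sum_Ico_eq_sum_range _ 1, harmonic]
  push_cast
  simp only [Finset.sum_div, ← Finset.range_eq_Ico]
  rw [← Finset.sum_sub_distrib]
  refine Finset.sum_congr rfl fun k _ => ?_
  rw [add_comm 1 (k : ℝ)]
  field_simp
  ring

end IsIndepBernoulli

section

variable {Ω Ω' : Type*} [MeasurableSpace Ω] [MeasurableSpace Ω'] {μ : Measure Ω} {P : Measure Ω'}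
  [IsProbabilityMeasure μ] [IsProbabilityMeasure P] {X : Ω → ℕ} {n : ℕ} {I : Fin n → Ω' → ℝ}

theorem IsIndepBernoulli.identDistrib (h : IsIndepBernoulli P n I) (hm : Measurable X)
    (hX : ∀ x : ℂ, ∫ ω, x ^ X ω ∂μ = bernoulliSumPGF n x) :
    IdentDistrib (fun ω => (X ω : ℝ)) (fun ω => ∑ i, I i ω) μ P := by
  have hm' : Measurable fun ω => (X ω : ℝ) := measurable_from_nat.comp hm
  have hI : Measurable fun ω => ∑ i, I i ω :=
    Finset.measurable_sum _ fun i _ => h.measurable i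
  refine ⟨hm'.aemeasurable, hI.aemeasurable, ?_⟩
  have := Measure.isProbabilityMeasure_map (μ := μ) hm'.aemeasurable
  have := Measure.isProbabilityMeasure_map (μ := P) hI.aemeasurable
  refine Measure.ext_of_charFun (funext fun t => ?_)
  rw [h.charFun_map_sum, ← hX, charFun_apply_real, integral_map hm'.aemeasurable (by fun_prop)]
  refine integral_congr_ae (ae_of_all _ fun ω => ?_)
  simp only [← Complex.exp_nat_mul]
  push_cast
  ring_nf

theorem integral_eq_of_pgf (hm : Measurable X)
    (hX : ∀ x : ℂ, ∫ ω, x ^ X ω ∂μ = bernoulliSumPGF n x) :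
    ∫ ω, (X ω : ℝ) ∂μ = n - (harmonic n : ℝ) / 2 := by
  obtain ⟨Ω', _, P, I, _, h⟩ := exists_isIndepBernoulli n
  rw [(h.identDistrib hm hX).integral_eq, h.integral_sum]

theorem variance_eq_of_pgf (hm : Measurable X)
    (hX : ∀ x : ℂ, ∫ ω, x ^ X ω ∂μ = bernoulliSumPGF n x) :
    Var[fun ω => (X ω : ℝ); μ] =
      (harmonic n : ℝ) / 2 - (∑ k ∈ Finset.Icc 1 n, 1 / (k : ℝ) ^ 2) / 4 := by
  obtain ⟨Ω', _, P, I, _, h⟩ := exists_isIndepBernoulli n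
  rw [(h.identDistrib hm hX).variance_eq, h.variance_sum]

/-- The two variables agree in law as real variables, with the same Bernoulli sum; taking the floor
brings this back to `ℕ`. -/
theorem identDistrib_of_pgf {ν : Measure Ω'} [IsProbabilityMeasure ν] {Y : Ω' → ℕ}
    (hm : Measurable X) (hX : ∀ x : ℂ, ∫ ω, x ^ X ω ∂μ = bernoulliSumPGF n x)
    (hm' : Measurable Y) (hY : ∀ x : ℂ, ∫ ω, x ^ Y ω ∂ν = bernoulliSumPGF n x) :
    IdentDistrib X Y μ ν := by
  obtain ⟨Ω', _, P, I, _, h⟩ := exists_isIndepBernoulli n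
  have := ((h.identDistrib hm hX).trans (h.identDistrib hm' hY).symm).comp
    (u := fun x : ℝ => ⌊x⌋₊) Nat.measurable_floor
  simpa [Function.comp_def] using this

end

/-! ### Asymptotic normality -/

theorem norm_prod_sub_prod_le_sum {ι : Type*} (s : Finset ι) (f g : ι → ℂ)
    (hf : ∀ i ∈ s, ‖f i‖ ≤ 1) (hg : ∀ i ∈ s, ‖g i‖ ≤ 1) :
    ‖∏ i ∈ s, f i - ∏ i ∈ s, g i‖ ≤ ∑ i ∈ s, ‖f i - g i‖ := by
  classical
  induction s using Finset.induction_on with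
  | empty => simp
  | insert a s ha ih =>
    rw [Finset.prod_insert ha, Finset.prod_insert ha, Finset.sum_insert ha]
    have ih := ih (fun i hi => hf i (Finset.mem_insert_of_mem hi))
      (fun i hi => hg i (Finset.mem_insert_of_mem hi))
    have hfs : ‖∏ i ∈ s, f i‖ ≤ 1 := (Finset.norm_prod_le _ _).trans <|
      Finset.prod_le_one (fun _ _ => norm_nonneg _) fun i hi => hf i (Finset.mem_insert_of_mem hi)
    calc ‖f a * ∏ i ∈ s, f i - g a * ∏ i ∈ s, g i‖
        = ‖(f a - g a) * ∏ i ∈ s, f i + g a * (∏ i ∈ s, f i - ∏ i ∈ s, g i)‖ := by ring_nf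
      _ ≤ ‖f a - g a‖ * ‖∏ i ∈ s, f i‖ + ‖g a‖ * ‖∏ i ∈ s, f i - ∏ i ∈ s, g i‖ := by
        simpa only [norm_mul] using norm_add_le ((f a - g a) * ∏ i ∈ s, f i)
          (g a * (∏ i ∈ s, f i - ∏ i ∈ s, g i))
      _ ≤ ‖f a - g a‖ * 1 + 1 * ∑ i ∈ s, ‖f i - g i‖ := by
        gcongr
        exact hg a (Finset.mem_insert_self a s)
      _ = _ := by ring

/-- Comparison of the Bernoulli and the Poisson characteristic functions: with `u = exp (i s) - 1`, each
factor `1 + u / (2k)` differs from `exp (u / (2k))` by at most `|u / (2k)|²`, and both have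
modulus at most `1`. -/
theorem norm_prod_sub_exp_le (s : ℝ) (n : ℕ) :
    ‖∏ k ∈ Finset.range n, (1 + (Complex.exp (s * Complex.I) - 1) / (2 * ((k : ℂ) + 1))) -
      Complex.exp ((Complex.exp (s * Complex.I) - 1) * (harmonic n : ℝ) / 2)‖ ≤
    ‖Complex.exp (s * Complex.I) - 1‖ ^ 2 * ∑' k : ℕ, 1 / ((k : ℝ) + 1) ^ 2 := by
  set e := Complex.exp (s * Complex.I) with he
  have he1 : ‖e‖ = 1 := Complex.norm_exp_ofReal_mul_I s
  have hk (k : ℕ) : ‖(2 * ((k : ℂ) + 1))‖ = 2 * ((k : ℝ) + 1) := by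
    rw [norm_mul, ← Nat.cast_succ, Complex.norm_natCast]
    simp
  have h2 (k : ℕ) : ‖(e - 1) / (2 * ((k : ℂ) + 1))‖ ≤ 1 := by
    have h3 : ‖e - 1‖ ≤ 2 := (norm_sub_le _ _).trans (by norm_num [he1])
    rw [norm_div, hk, div_le_one (by positivity)]
    have : (0 : ℝ) ≤ k := Nat.cast_nonneg k
    linarith
  have hexp : Complex.exp ((e - 1) * (harmonic n : ℝ) / 2) =
      ∏ k ∈ Finset.range n, Complex.exp ((e - 1) / (2 * ((k : ℂ) + 1))) := by
    rw [← Complex.exp_sum, harmonic]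
    congr 1
    push_cast
    rw [Finset.mul_sum, Finset.sum_div]
    refine Finset.sum_congr rfl fun k _ => ?_
    have : (k : ℂ) + 1 ≠ 0 := Nat.cast_add_one_ne_zero k
    field_simp
  rw [hexp]
  refine (norm_prod_sub_prod_le_sum _ _ _ (fun k _ => ?_) (fun k _ => ?_)).trans ?_
  · have h0 : (0 : ℝ) ≤ 1 - 1 / (2 * ((k : ℝ) + 1)) := by
      rw [sub_nonneg, div_le_one (by positivity)]
      have : (0 : ℝ) ≤ k := Nat.cast_nonneg k
      linarith
    have h1 : 1 + (e - 1) / (2 * ((k : ℂ) + 1)) =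
        ((1 - 1 / (2 * ((k : ℝ) + 1)) : ℝ) : ℂ) + e / (2 * ((k : ℂ) + 1)) := by
      push_cast
      ring
    rw [h1]
    refine (norm_add_le _ _).trans ?_
    rw [norm_div, hk, he1, Complex.norm_real, Real.norm_of_nonneg h0]
    linarith
  · rw [Complex.norm_exp, Real.exp_le_one_iff]
    have : (e - 1) / (2 * ((k : ℂ) + 1)) = (e - 1) / ((2 * ((k : ℝ) + 1) : ℝ) : ℂ) := by
      push_cast
      rfl
    rw [this, Complex.div_ofReal_re]
    refine div_nonpos_of_nonpos_of_nonneg ?_ (by positivity)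
    have := (Complex.re_le_norm e).trans he1.le
    simpa using this
  · have hs : Summable fun k : ℕ => 1 / ((k : ℝ) + 1) ^ 2 := by
      simpa using (summable_nat_add_iff 1).2 (Real.summable_one_div_nat_pow.2 one_lt_two)
    refine (Finset.sum_le_sum (g := fun k : ℕ => ‖e - 1‖ ^ 2 * (1 / ((k : ℝ) + 1) ^ 2))
      fun k _ => ?_).trans ?_
    · rw [norm_sub_rev, ← sub_sub]
      refine (Complex.norm_exp_sub_one_sub_id_le (h2 k)).trans ?_
      rw [norm_div, hk, div_pow, div_eq_mul_one_div]
      gcongr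
      linarith [Nat.cast_nonneg (α := ℝ) k]
    · rw [← Finset.mul_sum]
      gcongr
      exact hs.sum_le_tsum _ fun k _ => by positivity

/-- The characteristic function of the normalized variable converges to that of `N(0, 1)`. It suffices
that `L n → ∞` and `Hₙ - 2 L n` converges; the value of the limit plays no role. -/
theorem tendsto_exp_mul_prod_one_add {L : ℕ → ℝ} (hL : Tendsto L atTop atTop)
    (hH : Tendsto (fun n => (harmonic n : ℝ) - 2 * L n) atTop (nhds Real.eulerMascheroniConstant))
    (t : ℝ) :
    Tendsto (fun n => Complex.exp (((t / √(L n) : ℝ) : ℂ) * L n * Complex.I) *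
      ∏ k ∈ Finset.range n,
        (1 + (Complex.exp ((-(t / √(L n)) : ℝ) * Complex.I) - 1) / (2 * ((k : ℂ) + 1))))
      atTop (nhds (Complex.exp (-(t : ℂ) ^ 2 / 2))) := by
  set s : ℕ → ℝ := fun n => t / √(L n) with hs
  set u : ℕ → ℂ := fun n => Complex.exp ((-(s n) : ℝ) * Complex.I) - 1 with hu
  have hs0 : Tendsto s atTop (nhds 0) :=
    (Real.tendsto_sqrt_atTop.comp hL).const_div_atTop t
  have hu0 : Tendsto u atTop (nhds 0) := by
    have : Continuous fun r : ℝ => Complex.exp ((-r : ℝ) * Complex.I) - 1 := by fun_prop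
    have h := (this.tendsto 0).comp hs0
    rw [show Complex.exp ((-(0 : ℝ) : ℝ) * Complex.I) - 1 = 0 by simp] at h
    exact h
  have hLs : ∀ᶠ n in atTop, L n * s n ^ 2 = t ^ 2 := by
    filter_upwards [hL.eventually_gt_atTop 0] with n hn
    simp only [hs]
    rw [div_pow, Real.sq_sqrt hn.le]
    field_simp
  -- The third-order Taylor remainder of `u n`, which is `O(|s n|³) = o(1 / L n)`.
  have hR : Tendsto (fun n => (L n : ℂ) * (u n + s n * Complex.I + (s n : ℂ) ^ 2 / 2)) atTop
      (nhds 0) := by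
    have hb : Tendsto (fun n => t ^ 2 * (|s n| * Real.exp |s n|)) atTop (nhds 0) := by
      have : Continuous fun r : ℝ => t ^ 2 * (|r| * Real.exp |r|) := by fun_prop
      have h := (this.tendsto 0).comp hs0
      rw [abs_zero, zero_mul, mul_zero] at h
      exact h
    refine squeeze_zero_norm' ?_ hb
    filter_upwards [hL.eventually_gt_atTop 0, hLs] with n hn hn'
    have h := Complex.norm_exp_sub_sum_le_norm_mul_exp ((-(s n) : ℝ) * Complex.I) 3
    have e : Complex.exp ((-(s n) : ℝ) * Complex.I) -
        ∑ m ∈ Finset.range 3, (((-(s n) : ℝ) : ℂ) * Complex.I) ^ m / (m.factorial : ℂ) =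
        u n + s n * Complex.I + (s n : ℂ) ^ 2 / 2 := by
      simp [Finset.sum_range_succ, hu, mul_pow]
      ring
    rw [e] at h
    rw [norm_mul, Complex.norm_real, Real.norm_of_nonneg hn.le]
    have h3 : ‖((-(s n) : ℝ) : ℂ) * Complex.I‖ = |s n| := by simp
    rw [h3] at h
    calc L n * _ ≤ L n * (|s n| ^ 3 * Real.exp |s n|) := by gcongr
      _ = L n * |s n| ^ 2 * (|s n| * Real.exp |s n|) := by ring
      _ = _ := by rw [sq_abs, hn']
  have hexp : Tendsto (fun n => Complex.exp ((s n : ℂ) * L n * Complex.I) *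
      Complex.exp (u n * (harmonic n : ℝ) / 2)) atTop (nhds (Complex.exp (-(t : ℂ) ^ 2 / 2))) := by
    simp only [← Complex.exp_add]
    refine (Complex.continuous_exp.tendsto _).comp ?_
    have hH' : Tendsto (fun n => (((harmonic n : ℝ) - 2 * L n : ℝ) : ℂ)) atTop
        (nhds (Real.eulerMascheroniConstant : ℂ)) :=
      (Complex.continuous_ofReal.tendsto _).comp hH
    have h := (hR.add ((hu0.mul hH').div_const 2)).add (tendsto_const_nhds (x := -(t : ℂ) ^ 2 / 2))
    simp only [zero_mul, zero_div, add_zero, zero_add] at h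
    refine h.congr' ?_
    filter_upwards [hLs] with n hn
    have hn : (L n : ℂ) * (s n : ℂ) ^ 2 = (t : ℂ) ^ 2 := by exact_mod_cast hn
    rw [← hn]
    push_cast
    ring
  have hdiff : Tendsto (fun n => Complex.exp ((s n : ℂ) * L n * Complex.I) *
      (∏ k ∈ Finset.range n, (1 + u n / (2 * ((k : ℂ) + 1))) -
        Complex.exp (u n * (harmonic n : ℝ) / 2))) atTop (nhds 0) := by
    have hb : Tendsto (fun n => ‖u n‖ ^ 2 * ∑' k : ℕ, 1 / ((k : ℝ) + 1) ^ 2) atTop (nhds 0) := by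
      have h := (hu0.norm.pow 2).mul_const (∑' k : ℕ, 1 / ((k : ℝ) + 1) ^ 2)
      rwa [norm_zero, zero_pow two_ne_zero, zero_mul] at h
    refine squeeze_zero_norm (fun n => ?_) hb
    rw [norm_mul, ← Complex.ofReal_mul, Complex.norm_exp_ofReal_mul_I, one_mul]
    exact norm_prod_sub_exp_le (-(s n)) n
  have := hexp.add hdiff
  rw [add_zero] at this
  exact this.congr fun n => by ring

/-- Central limit theorem for variables whose law is given by `bernoulliSumPGF`. The variables may live
on different probability spaces. -/
theorem tendstoInDistribution_of_pgf {Ω : ℕ → Type*} [∀ n, MeasurableSpace (Ω n)]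
    {μ : ∀ n, Measure (Ω n)} [∀ n, IsProbabilityMeasure (μ n)] {X : ∀ n, Ω n → ℕ}
    (hm : ∀ n, Measurable (X n))
    (hX : ∀ n (x : ℂ), ∫ ω, x ^ X n ω ∂μ n = bernoulliSumPGF n x) :
    TendstoInDistribution
      (fun (n : ℕ) (ω : Ω n) => ((X n ω : ℝ) - n + Real.log n / 2) / √(Real.log n / 2))
      atTop (fun x : ℝ => x) μ (gaussianReal 0 1) := by
  have hm' (n : ℕ) : Measurable fun ω =>
      ((X n ω : ℝ) - n + Real.log n / 2) / √(Real.log n / 2) :=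
    (measurable_from_nat (f := fun k : ℕ =>
      ((k : ℝ) - n + Real.log n / 2) / √(Real.log n / 2))).comp (hm n)
  refine ⟨fun n => (hm' n).aemeasurable, by fun_prop,
    ProbabilityMeasure.tendsto_iff_tendsto_charFun.2 fun t => ?_⟩
  have hL : Tendsto (fun n : ℕ => Real.log n / 2) atTop atTop :=
    (Real.tendsto_log_atTop.comp tendsto_natCast_atTop_atTop).atTop_div_const two_pos
  have h := tendsto_exp_mul_prod_one_add hL
    (by simpa [mul_div_cancel₀] using Real.tendsto_harmonic_sub_log) t
  have e0 : charFun ((gaussianReal 0 1).map fun x : ℝ => x) t = Complex.exp (-(t : ℂ) ^ 2 / 2) := by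
    rw [Measure.map_id', charFun_gaussianReal]
    simp [neg_div]
  simp only [ProbabilityMeasure.coe_mk]
  rw [e0]
  refine h.congr fun n => ?_
  rw [charFun_apply_real, integral_map (hm' n).aemeasurable (by fun_prop)]
  set s : ℝ := t / √(Real.log n / 2) with hs
  set L : ℝ := Real.log n / 2
  have e1 (ω : Ω n) : Complex.exp (t * (((X n ω : ℝ) - n + L) / √L : ℝ) * Complex.I) =
      Complex.exp (s * L * Complex.I) * Complex.exp ((-s : ℝ) * Complex.I) ^ n *
        Complex.exp (s * Complex.I) ^ X n ω := by
    rw [← Complex.exp_nat_mul, ← Complex.exp_nat_mul, ← Complex.exp_add, ← Complex.exp_add, hs]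
    congr 1
    push_cast
    ring
  simp only [e1]
  have hpow : Complex.exp ((-s : ℝ) * Complex.I) ^ n =
      ∏ _k ∈ Finset.range n, Complex.exp ((-s : ℝ) * Complex.I) := by simp
  rw [integral_const_mul, hX, mul_assoc (Complex.exp (s * L * Complex.I)), bernoulliSumPGF, hpow,
    ← Finset.prod_mul_distrib]
  congr 1
  refine Finset.prod_congr rfl fun k _ => ?_
  have h1 : Complex.exp ((-s : ℝ) * Complex.I) * Complex.exp (s * Complex.I) = 1 := by
    rw [← Complex.exp_add]
    simp
  linear_combination (-1 + 1 / (2 * ((k : ℂ) + 1))) * h1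

theorem theorem8 :
    -- independent variables `I₁, …, Iₙ` with the stated laws exist
    (∀ n : ℕ, ∃ (Ω : Type) (_ : MeasurableSpace Ω) (P : Measure Ω) (I : Fin n → Ω → ℝ),
      IsProbabilityMeasure P ∧ IsIndepBernoulli P n I) ∧
    -- (i)
    (∀ n : ℕ, 1 ≤ n →
      (∀ {Ω : Type*} [MeasurableSpace Ω] (P : Measure Ω) [IsProbabilityMeasure P]
        (I : Fin n → Ω → ℝ), IsIndepBernoulli P n I →
        IdentDistrib (fun S : StaircaseTableau n => (S.Delta : ℝ)) (fun ω => ∑ i, I i ω)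
          (StaircaseTableau.unif n) P) ∧
      ∫ S : StaircaseTableau n, (S.Delta : ℝ) ∂(StaircaseTableau.unif n)
        = n - (harmonic n : ℝ) / 2 ∧
      Var[fun S : StaircaseTableau n => (S.Delta : ℝ); StaircaseTableau.unif n]
        = (harmonic n : ℝ) / 2 - (∑ k ∈ Finset.Icc 1 n, 1 / (k : ℝ) ^ 2) / 4) ∧
    TendstoInDistribution
      (fun (n : ℕ) (S : StaircaseTableau n) =>
        ((S.Delta : ℝ) - n + Real.log n / 2) / √(Real.log n / 2))
      atTop (fun x : ℝ => x) StaircaseTableau.unif (gaussianReal 0 1) ∧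
    -- (ii)
    (∀ n : ℕ, 1 ≤ n →
      IdentDistrib (fun S : StaircaseTableau n => S.Gamma) (fun S : StaircaseTableau n => S.Delta)
        (StaircaseTableau.unif n) (StaircaseTableau.unif n) ∧
      (∀ {Ω : Type*} [MeasurableSpace Ω] (P : Measure Ω) [IsProbabilityMeasure P]
        (I : Fin n → Ω → ℝ), IsIndepBernoulli P n I →
        IdentDistrib (fun S : StaircaseTableau n => (S.Gamma : ℝ)) (fun ω => ∑ i, I i ω)
          (StaircaseTableau.unif n) P) ∧
      ∫ S : StaircaseTableau n, (S.Gamma : ℝ) ∂(StaircaseTableau.unif n)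
        = n - (harmonic n : ℝ) / 2 ∧
      Var[fun S : StaircaseTableau n => (S.Gamma : ℝ); StaircaseTableau.unif n]
        = (harmonic n : ℝ) / 2 - (∑ k ∈ Finset.Icc 1 n, 1 / (k : ℝ) ^ 2) / 4) ∧
    TendstoInDistribution
      (fun (n : ℕ) (S : StaircaseTableau n) =>
        ((S.Gamma : ℝ) - n + Real.log n / 2) / √(Real.log n / 2))
      atTop (fun x : ℝ => x) StaircaseTableau.unif (gaussianReal 0 1) := by
  have hm (n : ℕ) (f : StaircaseTableau n → ℕ) : Measurable f := Measurable.of_discrete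
  refine ⟨exists_isIndepBernoulli, fun n _ => ⟨fun P _ I h => ?_, ?_, ?_⟩, ?_,
    fun n _ => ⟨?_, fun P _ I h => ?_, ?_, ?_⟩, ?_⟩
  · exact h.identDistrib (hm n _) (integral_pow_Delta n)
  · exact integral_eq_of_pgf (hm n _) (integral_pow_Delta n)
  · exact variance_eq_of_pgf (hm n _) (integral_pow_Delta n)
  · exact tendstoInDistribution_of_pgf (fun n => hm n _) integral_pow_Delta
  · exact identDistrib_of_pgf (hm n _) (integral_pow_Gamma n) (hm n _) (integral_pow_Delta n)
  · exact h.identDistrib (hm n _) (integral_pow_Gamma n)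
  · exact integral_eq_of_pgf (hm n _) (integral_pow_Gamma n)
  · exact variance_eq_of_pgf (hm n _) (integral_pow_Gamma n)
  · exact tendstoInDistribution_of_pgf (fun n => hm n _) integral_pow_Gamma
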